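/- Let $n,t,r\ge 1$ be integers with $t\le n$ and let $w,\ell\ge 0$ be integers. For $x\in\{\pm1\}^n$ let $O_x$ be the operator on $\mathbb C^{n+1}$ with basis $|0\rangle,\dots,|n\rangle$ given by $O_x|0\rangle=|0\rangle$ and $O_x|i\rangle=x_i|i\rangle$ for $1\le i\le n$. A quantum query algorithm $\mathcal A$ on $n$-bit inputs with $r$ adaptive rounds of $t$ parallel queries and $w$ auxiliary qubits consists of a unit vector $|\psi\rangle\in\mathbb C^{\{0,\dots,n\}^t\times[2^w]}$, unitary operators $U_1,\dots,U_{r-1}$ on this space, and a positive semi-definite operator $M$ on it with operator norm $\|M\|\le1$; its acceptance probability on input $x$ is $$f(x)=\Bigl\|\sqrt M\,(O_x^{\otimes t}\otimes I_{2^w})\,U_{r-1}\cdots U_2\,(O_x^{\otimes t}\otimes I_{2^w})\,U_1\,(O_x^{\otimes t}\otimes I_{2^w})\,|\psi\rangle\Bigr\|^2 .$$ For a finite set $V$ and $g\colon\{\pm1\}^V\to\mathbb R$ put $\hat g(S)=\mathbb E_x\bigl[g(x)\prod_{i\in S}x_i\bigr]$ for $S\subseteq V$, where $x$ is uniform on $\{\pm1\}^V$,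 and $L_{1,\ell}(g)=\sum_{S\subseteq V,\,|S|=\ell}|\hat g(S)|$. There are a universal constant $C$ and a function $\kappa$ with $$0\le\kappa(r,\ell)\le C\cdot r\ell\cdot\min\bigl\{2^{2r\ell},\ \ell^{4^r}\bigr\}\qquad\text{for all } r\ge1,\ \ell\ge0,$$ such that for all $n,t,r,w,\ell$ as above and every such algorithm $\mathcal A$ with acceptance probability $f$, $$L_{1,\ell}(f)\le 2^{\kappa(r,\ell)}\cdot t^\ell\cdot\Bigl(\frac nt\Bigr)^{\frac12\left\lfloor\frac{(2r-1)\ell}{2r}\right\rfloor}.$$ Moreover, for every restriction $\rho\in\{\pm1,*\}^n$, the same bound (with the same $n$) holds for $L_{1,\ell}(f|_\rho)$, where $f|_\rho\colon\{\pm1\}^{\rho^{-1}(*)}\to[0,1]$ is obtained from $f$ by fixing $x_i=\rho(i)$ for all $i$ with $\rho(i)\ne *$. -/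

import Mathlib

open scoped Kronecker

noncomputable section

/-! ### Fourier analysis on the cube `{±1}^ι`, with `{±1}` realized as `ℤˣ` -/

/-- The Fourier coefficient `f̂(S) = E_x [f(x) ∏_{i ∈ S} x_i]`, `x` uniform on `{±1}^ι`. -/
def cubeFourierCoeff {ι : Type*} [Fintype ι] [DecidableEq ι] (f : (ι → ℤˣ) → ℝ) (S : Finset ι) : ℝ :=
  (∑ x : ι → ℤˣ, f x * ∏ i ∈ S, ((x i : ℤ) : ℝ)) / 2 ^ Fintype.card ι

/-- The level-`ℓ` Fourier growth `L_{1,ℓ}(f) = ∑_{|S| = ℓ} |f̂(S)|`. -/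
def fourierGrowth {ι : Type*} [Fintype ι] [DecidableEq ι] (ℓ : ℕ) (f : (ι → ℤˣ) → ℝ) : ℝ :=
  ∑ S ∈ Finset.powersetCard ℓ (Finset.univ : Finset ι), |cubeFourierCoeff f S|

/-- The sub-function `f|_ρ` of `f` for a restriction `ρ ∈ {±1, *}^ι`, where `*` is `none`: the
coordinates with `ρ i = some b` are fixed to `b`, the others remain variables. -/
def restrictFun {ι : Type*} (f : (ι → ℤˣ) → ℝ) (ρ : ι → Option ℤˣ)
    (y : {i : ι // ρ i = none} → ℤˣ) : ℝ :=
  f fun i => if h : ρ i = none then y ⟨i, h⟩ else (ρ i).getD 1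

/-! ### Quantum query algorithms with parallel queries -/

/-- The matrix of the oracle `O_x` on `ℂ^{n+1}`, with `O_x |0⟩ = |0⟩` (the index `0` is `none`) and
`O_x |i⟩ = x_i |i⟩`. -/
def oracleMatrix {n : ℕ} (x : Fin n → ℤˣ) : Matrix (Option (Fin n)) (Option (Fin n)) ℂ :=
  Matrix.diagonal fun i => i.elim 1 fun j => ((x j : ℤ) : ℂ)

/-- The `t`-fold Kronecker power `M^{⊗t}`. -/
def tensorPower {κ : Type*} (t : ℕ) (M : Matrix κ κ ℂ) : Matrix (Fin t → κ) (Fin t → κ) ℂ :=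
  Matrix.of fun I J => ∏ k, M (I k) (J k)

/-- Labels of the computational basis: `t` query registers, each with a label in `{0, 1, …, n}`,
and `w` auxiliary qubits. -/
abbrev BasisLabel (n t w : ℕ) : Type := (Fin t → Option (Fin n)) × Fin (2 ^ w)

/-- The state space `ℂ^{{0,…,n}^t × [2^w]}` with its Hilbert space structure. -/
abbrev StateSpace (n t w : ℕ) : Type := EuclideanSpace ℂ (BasisLabel n t w)

/-- One layer of `t` parallel queries: the operator `O_x^{⊗t} ⊗ I_{2^w}`. -/
def queryLayer {n : ℕ} (t w : ℕ) (x : Fin n → ℤˣ) : StateSpace n t w →L[ℂ] StateSpace n t w :=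
  Matrix.toEuclideanCLM (𝕜 := ℂ)
    (tensorPower t (oracleMatrix x) ⊗ₖ (1 : Matrix (Fin (2 ^ w)) (Fin (2 ^ w)) ℂ))

/-- A quantum query algorithm on `n`-bit inputs with `r ≥ 1` adaptive rounds of `t` parallel queries
and `w` auxiliary qubits: a unit initial state, the `r - 1` unitaries applied between consecutive
query layers, and the positive semi-definite operator of norm at most `1` (the "accept" element of a
two-outcome measurement) measured after the last layer. -/
structure QueryAlgorithm (n r t w : ℕ) where
  /-- the initial state -/
  ψ : StateSpace n t w
  norm_ψ : ‖ψ‖ = 1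
  /-- `U i` is applied between the query layers `i` and `i + 1` (counted from `0`) -/
  U : Fin (r - 1) → unitary (StateSpace n t w →L[ℂ] StateSpace n t w)
  /-- the measurement operator -/
  M : StateSpace n t w →L[ℂ] StateSpace n t w
  M_nonneg : 0 ≤ M
  norm_M_le : ‖M‖ ≤ 1

namespace QueryAlgorithm

variable {n r t w : ℕ}

/-- The state `(O_x^{⊗t} ⊗ I) U_{r-1} ⋯ U_2 (O_x^{⊗t} ⊗ I) U_1 (O_x^{⊗t} ⊗ I) |ψ⟩` just before the
measurement. -/
def finalState (A : QueryAlgorithm n r t w) (x : Fin n → ℤˣ) : StateSpace n t w :=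
  Fin.foldl (r - 1)
    (fun φ i => queryLayer t w x ((A.U i : StateSpace n t w →L[ℂ] StateSpace n t w) φ))
    (queryLayer t w x A.ψ)

/-- The acceptance probability `‖√M φ_x‖²` on input `x`, where `φ_x` is the final state. -/
def acceptProb (A : QueryAlgorithm n r t w) (x : Fin n → ℤˣ) : ℝ :=
  ‖CFC.sqrt A.M (A.finalState x)‖ ^ 2

end QueryAlgorithm

end

/-!
The bound holds with the constant `9 ^ (r ℓ)`, hence with `κ r ℓ = 4 r ℓ`, by the following argument.

Flipping `x_i` multiplies the query layer by `1 - 2 P_i`, where `P_i` is the projection onto the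
basis labels that query `i` an odd number of times; as a label has only `t` query registers,
`∑_i ‖P_i φ‖² ≤ t ‖φ‖²`. A Fourier coefficient of level `ℓ` is, up to sign and a factor `2 ^ ℓ`, an
average over `x` of `ℓ`-fold discrete derivatives `∑_Z (-1)^{|Z|} f(x · flip_{s(Z)})` along a tuple
`s` of `ℓ` indices. In `f(x) = ⟨φ_x, M φ_x⟩` expand all `2r` query layers; the alternating sum keeps
only the terms in which every position `j` of `s` has its projection `P_{s j}` inserted in at least
one layer. The absolute coefficients add up to at most `9 ^ (r ℓ)`.

Fix such a term. Some layer carries the projections of a set `R` of at least `ℓ / 2r` positions. Cut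
the inner product there, keeping `P_R` on both sides, and apply Cauchy–Schwarz to the vectors and to
the sum over `s ∈ [n]^ℓ`. On each side, the squared norms add up to at most
`n ^ ℓ (t / n) ^ (number of positions occurring on that side)` (`sum_norm_sq_wordState_le`). The
positions in `R` occur on both sides and all others on at least one, so the term contributes at most
`t ^ ℓ (n / t) ^ ((ℓ - |R|) / 2)` (`sum_norm_inner_wordState_le`), with
`ℓ - |R| ≤ ⌊(2r - 1) ℓ / 2r⌋`.

The derivative bound holds at every point `x` (`QueryAlgorithm.sum_abs_cubeDeriv_le`), so it passes
to restrictions without change (`two_pow_mul_fourierGrowth_comp_le`).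
-/

noncomputable section

/-! ### Projections onto the basis labels that contain prescribed indices -/

/-- For a family `T` of finite sets indexed by basis labels and a tuple `s` of indices, the
orthogonal projection onto the span of the labels `J` with `s j ∈ T J` for every `j ∈ R`. The tuple
and the set of positions `R` are kept apart, because sums run over `s` for fixed `R`. -/
def hitProj {β ν : Type*} [Fintype β] [DecidableEq β] [DecidableEq ν] {ℓ : ℕ} (T : β → Finset ν)
    (s : Fin ℓ → ν) (R : Finset (Fin ℓ)) : EuclideanSpace ℂ β →L[ℂ] EuclideanSpace ℂ β :=
  Matrix.toEuclideanCLM (𝕜 := ℂ) (Matrix.diagonal fun J => if ∀ j ∈ R, s j ∈ T J then 1 else 0)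

/-- Averaging over a coordinate of a tuple before averaging over the tuple changes nothing. -/
theorem sum_sum_update_eq_card_mul {ν : Type*} [Fintype ν] {ℓ : ℕ} (F : (Fin ℓ → ν) → ℝ) (j : Fin ℓ) :
    ∑ s, ∑ i, F (Function.update s j i) = Fintype.card ν * ∑ s, F s := by
  have hinv : Function.Involutive
      (fun p : (Fin ℓ → ν) × ν => (Function.update p.1 j p.2, p.1 j)) := by
    intro p
    simp
  rw [← Fintype.sum_prod_type' (f := fun s i => F (Function.update s j i))]
  refine (Equiv.sum_comp hinv.toPerm (fun p : (Fin ℓ → ν) × ν => F p.1)).trans ?_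
  rw [Fintype.sum_prod_type]
  simp [Finset.mul_sum]

section HitProj

variable {β ν : Type*} [Fintype β] [DecidableEq β] [DecidableEq ν] {ℓ : ℕ} (T : β → Finset ν)

theorem hitProj_apply (s : Fin ℓ → ν) (R : Finset (Fin ℓ)) (φ : EuclideanSpace ℂ β) (J : β) :
    hitProj T s R φ J = if ∀ j ∈ R, s j ∈ T J then φ J else 0 := by
  simp only [hitProj, Matrix.ofLp_toEuclideanCLM, Matrix.mulVec_diagonal]
  split_ifs <;> simp

theorem hitProj_empty (s : Fin ℓ → ν) (φ : EuclideanSpace ℂ β) : hitProj T s ∅ φ = φ := by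
  ext J
  simp [hitProj_apply]

theorem hitProj_insert (s : Fin ℓ → ν) (j : Fin ℓ) (R : Finset (Fin ℓ)) (φ : EuclideanSpace ℂ β) :
    hitProj T s (insert j R) φ = hitProj T s {j} (hitProj T s R φ) := by
  ext J
  simp only [hitProj_apply, Finset.forall_mem_insert, Finset.mem_singleton, forall_eq]
  split_ifs <;> simp_all

theorem hitProj_idem (s : Fin ℓ → ν) (R : Finset (Fin ℓ)) (φ : EuclideanSpace ℂ β) :
    hitProj T s R (hitProj T s R φ) = hitProj T s R φ := by
  ext J
  simp only [hitProj_apply]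
  split_ifs <;> rfl

theorem inner_hitProj_right (s : Fin ℓ → ν) (R : Finset (Fin ℓ)) (φ χ : EuclideanSpace ℂ β) :
    inner ℂ φ (hitProj T s R χ) = inner ℂ (hitProj T s R φ) χ := by
  simp only [PiLp.inner_apply, hitProj_apply]
  refine Finset.sum_congr rfl fun J _ => ?_
  split_ifs <;> simp

theorem norm_sq_hitProj (s : Fin ℓ → ν) (R : Finset (Fin ℓ)) (φ : EuclideanSpace ℂ β) :
    ‖hitProj T s R φ‖ ^ 2 = ∑ J, if ∀ j ∈ R, s j ∈ T J then ‖φ J‖ ^ 2 else 0 := by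
  rw [EuclideanSpace.norm_sq_eq]
  refine Finset.sum_congr rfl fun J _ => ?_
  rw [hitProj_apply]
  split_ifs <;> simp

theorem norm_sq_hitProj_le (s : Fin ℓ → ν) (R : Finset (Fin ℓ)) (φ : EuclideanSpace ℂ β) :
    ‖hitProj T s R φ‖ ^ 2 ≤ ‖φ‖ ^ 2 := by
  rw [norm_sq_hitProj, EuclideanSpace.norm_sq_eq]
  refine Finset.sum_le_sum fun J _ => ?_
  split_ifs
  · exact le_rfl
  · positivity

theorem hitProj_congr {s s' : Fin ℓ → ν} {R : Finset (Fin ℓ)} (h : ∀ j ∈ R, s j = s' j) :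
    hitProj T s R = hitProj T s' R := by
  ext φ J
  simp only [hitProj_apply]
  congr 1
  exact propext (forall₂_congr fun j hj => by rw [h j hj])

/-- For a fixed vector, the projections at one position have total squared norm at most `t`,
since every label contains at most `t` indices. -/
theorem sum_norm_sq_hitProj_update_le [Fintype ν] {t : ℕ} (hT : ∀ J, (T J).card ≤ t)
    (s : Fin ℓ → ν) (j : Fin ℓ) (φ : EuclideanSpace ℂ β) :
    ∑ i, ‖hitProj T (Function.update s j i) {j} φ‖ ^ 2 ≤ t * ‖φ‖ ^ 2 := by
  simp only [norm_sq_hitProj, Finset.mem_singleton, forall_eq, Function.update_self]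
  rw [Finset.sum_comm, EuclideanSpace.norm_sq_eq, Finset.mul_sum]
  refine Finset.sum_le_sum fun J _ => ?_
  rw [← Finset.sum_filter, Finset.sum_const, nsmul_eq_mul, Finset.filter_univ_mem]
  gcongr
  exact hT J

/-- A position on which the vector does not yet depend gains a factor `t / n` when the projection at
that position is applied. -/
theorem sum_norm_sq_hitProj_singleton_le [Fintype ν] {t : ℕ} (hT : ∀ J, (T J).card ≤ t)
    (j : Fin ℓ) {W : Finset (Fin ℓ)} (hj : j ∉ W) {Φ : (Fin ℓ → ν) → EuclideanSpace ℂ β}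
    (hΦ : DependsOn Φ (W : Set (Fin ℓ))) :
    Fintype.card ν * ∑ s, ‖hitProj T s {j} (Φ s)‖ ^ 2 ≤ t * ∑ s, ‖Φ s‖ ^ 2 := by
  rw [← sum_sum_update_eq_card_mul _ j, Finset.mul_sum]
  refine Finset.sum_le_sum fun s _ => ?_
  have hup : ∀ i, Φ (Function.update s j i) = Φ s := fun i => hΦ fun k hk => by
    rw [Function.update_of_ne]
    rintro rfl
    exact hj hk
  simp only [hup]
  exact sum_norm_sq_hitProj_update_le T hT s j (Φ s)

theorem dependsOn_hitProj {W R : Finset (Fin ℓ)} {Φ : (Fin ℓ → ν) → EuclideanSpace ℂ β}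
    (hΦ : DependsOn Φ (W : Set (Fin ℓ))) :
    DependsOn (fun s => hitProj T s R (Φ s)) ((R ∪ W : Finset (Fin ℓ)) : Set (Fin ℓ)) := by
  intro s s' h
  have h1 : hitProj T s R = hitProj T s' R :=
    hitProj_congr T fun j hj => h j (by simp [hj])
  have h2 : Φ s = Φ s' := hΦ fun j hj => h j (by simpa using Or.inr hj)
  simp only [h1, h2]

/-- Every position of `R` on which `Φ` does not depend gains a factor `t / n`; the other positions
are discarded. -/
theorem sum_norm_sq_hitProj_le [Fintype ν] {t : ℕ} (hT : ∀ J, (T J).card ≤ t)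
    (hn : 0 < Fintype.card ν) {W : Finset (Fin ℓ)} {Φ : (Fin ℓ → ν) → EuclideanSpace ℂ β}
    (hΦ : DependsOn Φ (W : Set (Fin ℓ))) (R : Finset (Fin ℓ)) :
    ∑ s, ‖hitProj T s R (Φ s)‖ ^ 2 ≤
      ((t : ℝ) / Fintype.card ν) ^ (R \ W).card * ∑ s, ‖Φ s‖ ^ 2 := by
  induction R using Finset.induction_on with
  | empty => simp [hitProj_empty]
  | insert j R hjR ih =>
    simp only [hitProj_insert]
    by_cases hjW : j ∈ W
    · rw [Finset.insert_sdiff_of_mem _ hjW]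
      exact (Finset.sum_le_sum fun s _ => norm_sq_hitProj_le T s {j} _).trans ih
    · have hjRW : j ∉ R ∪ W := by simp [hjR, hjW]
      have hstep := sum_norm_sq_hitProj_singleton_le T hT j hjRW (dependsOn_hitProj T hΦ (R := R))
      have hn' : (0 : ℝ) < Fintype.card ν := by exact_mod_cast hn
      rw [Finset.insert_sdiff_of_notMem _ hjW, Finset.card_insert_of_notMem (by simp [hjR]),
        pow_succ', mul_assoc]
      rw [← le_div_iff₀' hn'] at hstep
      refine hstep.trans ?_
      rw [mul_div_right_comm]
      gcongr

end HitProj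

/-! ### Words alternating contractions and projections -/

/-- The vector `P_{R_m} A_m ⋯ P_{R_1} A_1 u` given by a word with letters `(A_i, R_i)`, the last
letter first, where `P_R = hitProj T s R`. -/
def wordState {β ν : Type*} [Fintype β] [DecidableEq β] [DecidableEq ν] {ℓ : ℕ} (T : β → Finset ν)
    (u : EuclideanSpace ℂ β) (s : Fin ℓ → ν) :
    List ((EuclideanSpace ℂ β →L[ℂ] EuclideanSpace ℂ β) × Finset (Fin ℓ)) → EuclideanSpace ℂ β
  | [] => u
  | a :: w => hitProj T s a.2 (a.1 (wordState T u s w))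

/-- The set of positions occurring in a word. -/
def wordSupport {α : Type*} {ℓ : ℕ} : List (α × Finset (Fin ℓ)) → Finset (Fin ℓ)
  | [] => ∅
  | a :: w => a.2 ∪ wordSupport w

section Words

variable {β ν : Type*} [Fintype β] [DecidableEq β] [DecidableEq ν] {ℓ : ℕ} (T : β → Finset ν)

theorem dependsOn_wordState (u : EuclideanSpace ℂ β)
    (w : List ((EuclideanSpace ℂ β →L[ℂ] EuclideanSpace ℂ β) × Finset (Fin ℓ))) :
    DependsOn (fun s => wordState T u s w) (wordSupport w : Set (Fin ℓ)) := by
  induction w with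
  | nil => exact fun _ _ _ => rfl
  | cons a w ih =>
    exact dependsOn_hitProj T (Φ := fun s => a.1 (wordState T u s w))
      fun s s' h => congrArg a.1 (ih h)

/-- Every position occurring in a word of contractions gains a factor `t / n`. -/
theorem sum_norm_sq_wordState_le [Fintype ν] {t : ℕ} (hT : ∀ J, (T J).card ≤ t)
    (hn : 0 < Fintype.card ν) {u : EuclideanSpace ℂ β} (hu : ‖u‖ ≤ 1)
    (w : List ((EuclideanSpace ℂ β →L[ℂ] EuclideanSpace ℂ β) × Finset (Fin ℓ)))
    (hw : ∀ a ∈ w, ‖a.1‖ ≤ 1) :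
    ∑ s, ‖wordState T u s w‖ ^ 2 ≤
      ((t : ℝ) / Fintype.card ν) ^ (wordSupport w).card * (Fintype.card ν : ℝ) ^ ℓ := by
  induction w with
  | nil =>
    have : ‖u‖ ^ 2 ≤ 1 := pow_le_one₀ (norm_nonneg _) hu
    simp only [wordState, wordSupport, Finset.sum_const, Finset.card_empty, pow_zero, one_mul,
      nsmul_eq_mul, Finset.card_univ, Fintype.card_fun, Fintype.card_fin, Nat.cast_pow]
    exact mul_le_of_le_one_right (by positivity) this
  | cons a w ih =>
    have hdep : DependsOn (fun s => a.1 (wordState T u s w)) (wordSupport w : Set (Fin ℓ)) :=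
      fun s s' h => congrArg a.1 (dependsOn_wordState T u w h)
    refine (sum_norm_sq_hitProj_le T hT hn hdep a.2).trans ?_
    have hcard : (wordSupport (a :: w)).card = (a.2 \ wordSupport w).card + (wordSupport w).card :=
      (Finset.card_sdiff_add_card a.2 (wordSupport w)).symm
    rw [hcard, pow_add, mul_assoc]
    refine mul_le_mul_of_nonneg_left ?_ (by positivity)
    refine le_trans (Finset.sum_le_sum fun s _ => ?_) (ih fun b hb => hw b (by simp [hb]))
    have := a.1.le_of_opNorm_le (hw a (by simp)) (wordState T u s w)
    rw [one_mul] at this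
    gcongr

/-- A projection in the right-hand word, being self-adjoint and idempotent, can be applied on the
left-hand side as well. -/
theorem inner_wordState_cons (u v : EuclideanSpace ℂ β) (s : Fin ℓ → ν)
    (M : EuclideanSpace ℂ β →L[ℂ] EuclideanSpace ℂ β)
    (a : (EuclideanSpace ℂ β →L[ℂ] EuclideanSpace ℂ β) × Finset (Fin ℓ))
    (w w' : List ((EuclideanSpace ℂ β →L[ℂ] EuclideanSpace ℂ β) × Finset (Fin ℓ))) :
    inner ℂ (wordState T v s w') (M (wordState T u s (a :: w))) =
      inner ℂ (wordState T v s ((M.adjoint, a.2) :: w')) (a.1 (wordState T u s w)) := by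
  simp only [wordState]
  rw [← inner_hitProj_right, ContinuousLinearMap.adjoint_inner_left]

/-- Cauchy–Schwarz at a letter `a` with many positions: these positions are counted on both sides,
every other one at least once. -/
theorem sum_norm_inner_wordState_cons_le [Fintype ν] {t : ℕ} (hT : ∀ J, (T J).card ≤ t)
    (ht : t ≤ Fintype.card ν) (hn : 0 < Fintype.card ν) {u v : EuclideanSpace ℂ β}
    (hu : ‖u‖ ≤ 1) (hv : ‖v‖ ≤ 1) {e : ℕ}
    (M : EuclideanSpace ℂ β →L[ℂ] EuclideanSpace ℂ β) (hM : ‖M‖ ≤ 1)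
    (a : (EuclideanSpace ℂ β →L[ℂ] EuclideanSpace ℂ β) × Finset (Fin ℓ)) (ha : ℓ ≤ a.2.card + e)
    (w w' : List ((EuclideanSpace ℂ β →L[ℂ] EuclideanSpace ℂ β) × Finset (Fin ℓ)))
    (hw : ∀ b ∈ a :: w, ‖b.1‖ ≤ 1) (hw' : ∀ b ∈ w', ‖b.1‖ ≤ 1) (he : e ≤ ℓ)
    (hcov : wordSupport (a :: w) ∪ wordSupport w' = Finset.univ) :
    ∑ s, ‖(inner ℂ (wordState T v s w') (M (wordState T u s (a :: w))) : ℂ)‖ ≤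
      √(((t : ℝ) / Fintype.card ν) ^ (2 * ℓ - e) * ((Fintype.card ν : ℝ) ^ ℓ) ^ 2) := by
  set q : ℝ := (t : ℝ) / Fintype.card ν with hq
  set N : ℝ := (Fintype.card ν : ℝ) ^ ℓ with hN
  have hq0 : 0 ≤ q := by positivity
  have hq1 : q ≤ 1 := by
    rw [hq, div_le_one (by exact_mod_cast hn)]
    exact_mod_cast ht
  have hpoint : ∀ s, ‖(inner ℂ (wordState T v s w') (M (wordState T u s (a :: w))) : ℂ)‖ ≤
      ‖wordState T v s ((M.adjoint, a.2) :: w')‖ * ‖wordState T u s (a :: w)‖ := by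
    intro s
    have hinner : (inner ℂ (wordState T v s w') (M (wordState T u s (a :: w))) : ℂ) =
        inner ℂ (wordState T v s ((M.adjoint, a.2) :: w')) (wordState T u s (a :: w)) := by
      rw [inner_wordState_cons]
      simp only [wordState]
      rw [inner_hitProj_right, hitProj_idem]
    rw [hinner]
    exact norm_inner_le_norm _ _
  have hL := sum_norm_sq_wordState_le T hT hn hv ((M.adjoint, a.2) :: w') (by
    intro b hb
    rcases List.mem_cons.1 hb with rfl | hb
    · simpa using hM
    · exact hw' b hb)
  have hR := sum_norm_sq_wordState_le T hT hn hu (a :: w) hw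
  refine Real.le_sqrt_of_sq_le ?_
  refine (pow_le_pow_left₀ (Finset.sum_nonneg fun s _ => norm_nonneg _)
    (Finset.sum_le_sum fun s _ => hpoint s) 2).trans ?_
  refine (Finset.sum_mul_sq_le_sq_mul_sq _ _ _).trans ?_
  refine (mul_le_mul hL hR (Finset.sum_nonneg fun s _ => by positivity) (by positivity)).trans ?_
  rw [← hq, mul_mul_mul_comm, ← pow_add, ← sq]
  refine mul_le_mul_of_nonneg_right (pow_le_pow_of_le_one hq0 hq1 ?_) (by positivity)
  have hunion : wordSupport ((M.adjoint, a.2) :: w') ∪ wordSupport (a :: w) = Finset.univ := by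
    rw [← hcov]
    simp only [wordSupport]
    grind
  have hinter : a.2 ⊆ wordSupport ((M.adjoint, a.2) :: w') ∩ wordSupport (a :: w) := by
    simp only [wordSupport]
    grind
  have h1 := Finset.card_union_add_card_inter (wordSupport ((M.adjoint, a.2) :: w'))
    (wordSupport (a :: w))
  have h2 := Finset.card_le_card hinter
  rw [hunion, Finset.card_univ, Fintype.card_fin] at h1
  omega

/-- The bound of `sum_norm_inner_wordState_cons_le` when the letter with many positions is anywhere
in the right-hand word: letters in front of it are shifted to the left-hand word. -/
theorem sum_norm_inner_wordState_le_of_mem [Fintype ν] {t : ℕ} (hT : ∀ J, (T J).card ≤ t)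
    (ht : t ≤ Fintype.card ν) (hn : 0 < Fintype.card ν) {u v : EuclideanSpace ℂ β}
    (hu : ‖u‖ ≤ 1) (hv : ‖v‖ ≤ 1) {e : ℕ} (he : e ≤ ℓ)
    (w : List ((EuclideanSpace ℂ β →L[ℂ] EuclideanSpace ℂ β) × Finset (Fin ℓ))) :
    ∀ (w' : List ((EuclideanSpace ℂ β →L[ℂ] EuclideanSpace ℂ β) × Finset (Fin ℓ)))
      (M : EuclideanSpace ℂ β →L[ℂ] EuclideanSpace ℂ β), ‖M‖ ≤ 1 →
      (∃ a ∈ w, ℓ ≤ a.2.card + e) → (∀ b ∈ w, ‖b.1‖ ≤ 1) → (∀ b ∈ w', ‖b.1‖ ≤ 1) →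
      wordSupport w ∪ wordSupport w' = Finset.univ →
      ∑ s, ‖(inner ℂ (wordState T v s w') (M (wordState T u s w)) : ℂ)‖ ≤
        √(((t : ℝ) / Fintype.card ν) ^ (2 * ℓ - e) * ((Fintype.card ν : ℝ) ^ ℓ) ^ 2) := by
  induction w with
  | nil => simp
  | cons a w ih =>
    intro w' M hM hmem hw hw' hcov
    by_cases ha : ℓ ≤ a.2.card + e
    · exact sum_norm_inner_wordState_cons_le T hT ht hn hu hv M hM a ha w w' hw hw' he hcov
    · simp only [inner_wordState_cons]
      refine ih _ _ (hw a (by simp)) ?_ (fun b hb => hw b (by simp [hb])) ?_ ?_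
      · obtain ⟨b, hb, hbe⟩ := hmem
        rcases List.mem_cons.1 hb with rfl | hb
        · exact absurd hbe ha
        · exact ⟨b, hb, hbe⟩
      · intro b hb
        rcases List.mem_cons.1 hb with rfl | hb
        · simpa using hM
        · exact hw' b hb
      · rw [← hcov]
        simp only [wordSupport]
        grind

theorem card_wordSupport_le {α : Type*} {b : ℕ} (w : List (α × Finset (Fin ℓ)))
    (hw : ∀ a ∈ w, a.2.card ≤ b) : (wordSupport w).card ≤ w.length * b := by
  induction w with
  | nil => simp [wordSupport]
  | cons a w ih =>
    have h1 := ih fun c hc => hw c (by simp [hc])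
    have h2 := hw a (by simp)
    have h3 := Finset.card_union_le a.2 (wordSupport w)
    simp only [wordSupport, List.length_cons, add_mul, one_mul]
    omega

/-- If the words have length `r` and cover all positions, then one of the `2r` letters carries at
least `ℓ / 2r` positions, and Cauchy–Schwarz is applied there. -/
theorem sum_norm_inner_wordState_le [Fintype ν] {t : ℕ} (hT : ∀ J, (T J).card ≤ t)
    (ht : t ≤ Fintype.card ν) (hn : 0 < Fintype.card ν) {u : EuclideanSpace ℂ β}
    (hu : ‖u‖ ≤ 1) {r e : ℕ} (hr : 1 ≤ r) (he : e ≤ ℓ) (hre : (2 * r - 1) * ℓ < 2 * r * (e + 1))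
    (w w' : List ((EuclideanSpace ℂ β →L[ℂ] EuclideanSpace ℂ β) × Finset (Fin ℓ)))
    (M : EuclideanSpace ℂ β →L[ℂ] EuclideanSpace ℂ β) (hM : ‖M‖ ≤ 1)
    (hlen : w.length = r) (hlen' : w'.length = r)
    (hw : ∀ b ∈ w, ‖b.1‖ ≤ 1) (hw' : ∀ b ∈ w', ‖b.1‖ ≤ 1)
    (hcov : wordSupport w ∪ wordSupport w' = Finset.univ) :
    ∑ s, ‖(inner ℂ (wordState T u s w') (M (wordState T u s w)) : ℂ)‖ ≤
      √(((t : ℝ) / Fintype.card ν) ^ (2 * ℓ - e) * ((Fintype.card ν : ℝ) ^ ℓ) ^ 2) := by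
  by_cases h : ∃ a ∈ w, ℓ ≤ a.2.card + e
  · exact sum_norm_inner_wordState_le_of_mem T hT ht hn hu hu he w w' M hM h hw hw' hcov
  by_cases h' : ∃ a ∈ w', ℓ ≤ a.2.card + e
  · have hswap : ∀ s, ‖(inner ℂ (wordState T u s w') (M (wordState T u s w)) : ℂ)‖ =
        ‖(inner ℂ (wordState T u s w) (M.adjoint (wordState T u s w')) : ℂ)‖ := fun s => by
      rw [ContinuousLinearMap.adjoint_inner_right,
        norm_inner_symm]
    simp only [hswap]
    exact sum_norm_inner_wordState_le_of_mem T hT ht hn hu hu he w' w M.adjoint (by simpa using hM)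
      h' hw' hw (by rw [Finset.union_comm, hcov])
  exfalso
  push Not at h h'
  obtain ⟨a, ha⟩ : ∃ a, a ∈ w := List.exists_mem_of_length_pos (by omega)
  have hpos := h a ha
  have h1 := card_wordSupport_le (b := ℓ - e - 1) w fun c hc => by have := h c hc; omega
  have h2 := card_wordSupport_le (b := ℓ - e - 1) w' fun c hc => by have := h' c hc; omega
  have h3 := Finset.card_union_le (wordSupport w) (wordSupport w')
  rw [hcov, Finset.card_univ, Fintype.card_fin] at h3
  rw [hlen] at h1
  rw [hlen'] at h2
  obtain ⟨b, hb⟩ : ∃ b, ℓ = e + 1 + b := ⟨ℓ - e - 1, by omega⟩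
  have hb' : ℓ - e - 1 = b := by omega
  rw [hb'] at h1 h2
  obtain ⟨r', rfl⟩ : ∃ r', r = r' + 1 := ⟨r - 1, by omega⟩
  have h4 : 2 * (r' + 1) - 1 = 2 * r' + 1 := by omega
  rw [h4] at hre
  nlinarith

end Words

/-! ### Flipping input bits in a query layer -/

/-- The indices that are queried an odd number of times by a basis label. -/
def oddQueries {n t w : ℕ} (J : BasisLabel n t w) : Finset (Fin n) :=
  {i | Odd (Finset.card {k | J.1 k = some i})}

/-- The eigenvalue of the query layer `O_x^{⊗t} ⊗ I` at a basis label. -/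
def queryPhase {n t w : ℕ} (x : Fin n → ℤˣ) (J : BasisLabel n t w) : ℂ :=
  ∏ k, (J.1 k).elim 1 fun j => ((x j : ℤ) : ℂ)

/-- The point of the cube `{±1}^ι` with `-1` at the coordinates `s j`, `j ∈ Z`, for injective `s`.
Multiplying by it flips these coordinates. -/
def signFlip {ι : Type*} [DecidableEq ι] {ℓ : ℕ} (s : Fin ℓ → ι) (Z : Finset (Fin ℓ)) : ι → ℤˣ :=
  ∏ j ∈ Z, Pi.mulSingle (s j) (-1)

section QueryLayer

variable {n t w : ℕ}

theorem card_oddQueries_le (J : BasisLabel n t w) : (oddQueries J).card ≤ t := by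
  have h : (oddQueries J).map Function.Embedding.some ⊆ Finset.univ.image J.1 := by
    intro o ho
    obtain ⟨i, hi, rfl⟩ := Finset.mem_map.1 ho
    obtain ⟨k, hk⟩ := Finset.card_pos.1 (Finset.mem_filter.1 hi).2.pos
    exact Finset.mem_image.2 ⟨k, Finset.mem_univ _, (Finset.mem_filter.1 hk).2⟩
  calc (oddQueries J).card = ((oddQueries J).map Function.Embedding.some).card :=
        (Finset.card_map _).symm
    _ ≤ (Finset.univ.image J.1).card := Finset.card_le_card h
    _ ≤ t := Finset.card_image_le.trans (by simp)

theorem queryLayer_apply (x : Fin n → ℤˣ) (φ : StateSpace n t w) (J : BasisLabel n t w) :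
    queryLayer t w x φ J = queryPhase x J * φ J := by
  have hdiag : tensorPower t (oracleMatrix x) ⊗ₖ (1 : Matrix (Fin (2 ^ w)) (Fin (2 ^ w)) ℂ) =
      Matrix.diagonal (queryPhase x) := by
    ext I J
    simp only [Matrix.kroneckerMap_apply, tensorPower, Matrix.of_apply, oracleMatrix,
      Matrix.one_apply, Matrix.diagonal_apply]
    by_cases hIJ : I = J
    · subst hIJ
      simp [queryPhase]
    · rw [if_neg hIJ]
      by_cases h2 : I.2 = J.2
      · obtain ⟨k, hk⟩ := Function.ne_iff.1 fun h1 : I.1 = J.1 => hIJ (Prod.ext h1 h2)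
        rw [Finset.prod_eq_zero (Finset.mem_univ k) (if_neg hk), zero_mul]
      · rw [if_neg h2, mul_zero]
  rw [queryLayer, hdiag, Matrix.ofLp_toEuclideanCLM, Matrix.mulVec_diagonal]

theorem norm_intUnit (u : ℤˣ) : ‖((u : ℤ) : ℂ)‖ = 1 := by
  rcases Int.units_eq_one_or u with rfl | rfl <;> simp

theorem norm_queryPhase (x : Fin n → ℤˣ) (J : BasisLabel n t w) : ‖queryPhase x J‖ = 1 := by
  rw [queryPhase, norm_prod]
  refine Finset.prod_eq_one fun k _ => ?_
  cases J.1 k with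
  | none => simp
  | some i => exact norm_intUnit (x i)

theorem norm_queryLayer_le (x : Fin n → ℤˣ) : ‖queryLayer t w x‖ ≤ 1 := by
  refine ContinuousLinearMap.opNorm_le_bound _ zero_le_one fun φ => ?_
  rw [one_mul, EuclideanSpace.norm_eq, EuclideanSpace.norm_eq]
  simp [queryLayer_apply, norm_queryPhase]

theorem queryPhase_mul (x y : Fin n → ℤˣ) (J : BasisLabel n t w) :
    queryPhase (x * y) J = queryPhase x J * queryPhase y J := by
  rw [queryPhase, queryPhase, queryPhase, ← Finset.prod_mul_distrib]
  refine Finset.prod_congr rfl fun k _ => ?_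
  cases J.1 k <;> simp

theorem queryPhase_mulSingle (i : Fin n) (J : BasisLabel n t w) :
    queryPhase (Pi.mulSingle i (-1)) J = if i ∈ oddQueries J then -1 else 1 := by
  have h : ∀ k, (J.1 k).elim (1 : ℂ)
      (fun j => (((Pi.mulSingle i (-1) : Fin n → ℤˣ) j : ℤ) : ℂ)) =
        if J.1 k = some i then -1 else 1 := by
    intro k
    cases J.1 k with
    | none => simp
    | some j =>
      by_cases hji : j = i
      · subst hji
        simp
      · simp [hji]
  simp only [queryPhase, h, Finset.prod_ite, Finset.prod_const, mul_one,
    oddQueries, Finset.mem_filter, Finset.mem_univ, true_and, one_pow]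
  split_ifs with hodd
  · exact Odd.neg_one_pow hodd
  · exact (Nat.not_odd_iff_even.1 hodd).neg_one_pow

theorem queryPhase_signFlip {ℓ : ℕ} (s : Fin ℓ → Fin n) (Z : Finset (Fin ℓ))
    (J : BasisLabel n t w) :
    queryPhase (signFlip s Z) J = ∏ j ∈ Z, if s j ∈ oddQueries J then -1 else 1 := by
  induction Z using Finset.induction_on with
  | empty =>
    rw [Finset.prod_empty, queryPhase]
    refine Finset.prod_eq_one fun k _ => ?_
    cases J.1 k <;> simp [signFlip]
  | insert j Z hj ih =>
    rw [Finset.prod_insert hj, ← ih, ← queryPhase_mulSingle, ← queryPhase_mul, signFlip,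
      Finset.prod_insert hj, signFlip]

/-- Flipping an input bit multiplies the query layer by `1 - 2P` with a projection `P`; flipping
several, by the product of these operators, expanded here. -/
theorem queryLayer_mul_signFlip {ℓ : ℕ} (x : Fin n → ℤˣ) (s : Fin ℓ → Fin n)
    (Z : Finset (Fin ℓ)) (φ : StateSpace n t w) :
    queryLayer t w (x * signFlip s Z) φ =
      ∑ R : Finset (Fin ℓ), if R ⊆ Z then
        ((-2 : ℂ) ^ R.card) • hitProj oddQueries s R (queryLayer t w x φ) else 0 := by
  rw [← Finset.sum_filter]
  have hfilter : Finset.univ.filter (fun R : Finset (Fin ℓ) => R ⊆ Z) = Z.powerset := by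
    ext R
    simp
  rw [hfilter]
  ext J
  simp only [WithLp.ofLp_sum, Finset.sum_apply, WithLp.ofLp_smul, Pi.smul_apply, smul_eq_mul,
    hitProj_apply, queryLayer_apply, queryPhase_mul, queryPhase_signFlip]
  have hfac : ∀ j, (if s j ∈ oddQueries J then (-1 : ℂ) else 1) =
      1 + if s j ∈ oddQueries J then -2 else 0 := by
    intro j
    split_ifs <;> norm_num
  simp only [hfac, Finset.prod_one_add, Finset.mul_sum, Finset.sum_mul]
  refine Finset.sum_congr rfl fun R _ => ?_
  rw [Finset.prod_ite_zero, Finset.prod_const]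
  split_ifs <;> ring

/-! ### Expansion of the acceptance probability -/

/-- The state after `m + 1` query layers on a flipped input, as a combination of words whose letters
come from the unflipped input; a word occurs if all its positions are flipped. -/
theorem exists_word_expansion (ℓ : ℕ) (x : Fin n → ℤˣ) (ψ : StateSpace n t w) (m : ℕ) :
    ∀ V : Fin m → (StateSpace n t w →L[ℂ] StateSpace n t w), (∀ i, ‖V i‖ ≤ 1) →
    ∃ (ι : Type) (_ : Fintype ι) (c : ι → ℂ)
      (word : ι → List ((StateSpace n t w →L[ℂ] StateSpace n t w) × Finset (Fin ℓ))),
      ∑ i, ‖c i‖ = (3 ^ ℓ) ^ (m + 1) ∧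
      (∀ i, (word i).length = m + 1 ∧ ∀ a ∈ word i, ‖a.1‖ ≤ 1) ∧
      ∀ (s : Fin ℓ → Fin n) (Z : Finset (Fin ℓ)),
        Fin.foldl m (fun φ i => queryLayer t w (x * signFlip s Z) (V i φ))
            (queryLayer t w (x * signFlip s Z) ψ) =
          ∑ i, if wordSupport (word i) ⊆ Z then c i • wordState oddQueries ψ s (word i) else 0 := by
  have hweight : ∑ R : Finset (Fin ℓ), ‖(-2 : ℂ) ^ R.card‖ = 3 ^ ℓ := by
    have h := Fintype.sum_pow_mul_eq_add_pow (Fin ℓ) (2 : ℝ) 1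
    simp only [one_pow, mul_one, Fintype.card_fin] at h
    norm_num at h
    simpa using h
  induction m with
  | zero =>
    intro V _
    refine ⟨Finset (Fin ℓ), inferInstance, fun R => (-2) ^ R.card,
      fun R => [(queryLayer t w x, R)], by simpa using hweight, ?_, ?_⟩
    · intro R
      simpa using norm_queryLayer_le x
    · intro s Z
      rw [Fin.foldl_zero, queryLayer_mul_signFlip]
      simp [wordSupport, wordState]
  | succ m ih =>
    intro V hV
    obtain ⟨ι, _, c, word, hc, hword, hexp⟩ := ih (fun i => V i.castSucc) fun i => hV _
    refine ⟨Finset (Fin ℓ) × ι, inferInstance, fun p => (-2) ^ p.1.card * c p.2,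
      fun p => (queryLayer t w x * V (Fin.last m), p.1) :: word p.2, ?_, ?_, ?_⟩
    · rw [pow_succ' _ (m + 1), ← hc, ← hweight, Finset.sum_mul_sum, Fintype.sum_prod_type]
      simp only [norm_mul]
    · rintro ⟨R, i⟩
      refine ⟨by simp [(hword i).1], fun a ha => ?_⟩
      rcases List.mem_cons.1 ha with rfl | ha
      · exact (norm_mul_le _ _).trans
          (mul_le_one₀ (norm_queryLayer_le x) (norm_nonneg _) (hV _))
      · exact (hword i).2 a ha
    · intro s Z
      rw [Fin.foldl_succ_last, hexp s Z, queryLayer_mul_signFlip, Fintype.sum_prod_type]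
      refine Finset.sum_congr rfl fun R _ => ?_
      by_cases hR : R ⊆ Z
      · rw [if_pos hR, map_sum, map_sum, map_sum, Finset.smul_sum]
        refine Finset.sum_congr rfl fun i _ => ?_
        by_cases hi : wordSupport (word i) ⊆ Z
        · rw [if_pos hi, if_pos (by simpa [wordSupport] using Finset.union_subset hR hi)]
          simp only [map_smul, wordState, mul_apply_eq_comp, smul_smul]
        · rw [if_neg hi]
          simp only [map_zero, smul_zero]
          exact (if_neg fun h => hi (Finset.union_subset_right h)).symm
      · rw [if_neg hR]
        symm
        exact Finset.sum_eq_zero fun i _ => if_neg fun h => hR (Finset.union_subset_left h)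

end QueryLayer

/-- In an alternating sum over all sets, the supersets of `U` cancel unless `U` is everything. -/
theorem norm_sum_neg_one_pow_superset {α : Type*} [Fintype α] [DecidableEq α] (U : Finset α)
    (z : ℂ) :
    ‖∑ Z : Finset α, (-1) ^ Z.card * (if U ⊆ Z then z else 0)‖ =
      if U = Finset.univ then ‖z‖ else 0 := by
  split_ifs with hU
  · subst hU
    simp [Finset.univ_subset_iff]
  · obtain ⟨j, hj⟩ : ∃ j, j ∉ U := by
      by_contra! h
      exact hU (Finset.eq_univ_iff_forall.2 h)
    rw [norm_eq_zero]
    refine Finset.sum_involution (fun Z _ => symmDiff Z {j}) ?_ ?_ (fun _ _ => Finset.mem_univ _)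
      (fun Z _ => symmDiff_symmDiff_cancel_right _ _)
    · intro Z _
      have hsub : U ⊆ symmDiff Z {j} ↔ U ⊆ Z := by
        simp only [Finset.subset_iff, Finset.mem_symmDiff, Finset.mem_singleton]
        grind
      have hpow : (-1 : ℂ) ^ (symmDiff Z {j}).card = -(-1) ^ Z.card := by
        by_cases hjZ : j ∈ Z
        · have h1 : symmDiff Z {j} = Z.erase j := by
            ext i
            simp only [Finset.mem_symmDiff, Finset.mem_singleton, Finset.mem_erase]
            grind
          rw [h1, ← Finset.card_erase_add_one hjZ, pow_succ]
          ring
        · have h1 : symmDiff Z {j} = insert j Z := by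
            ext i
            simp only [Finset.mem_symmDiff, Finset.mem_singleton, Finset.mem_insert]
            grind
          rw [h1, Finset.card_insert_of_notMem hjZ, pow_succ]
          ring
      simp only [hsub, hpow]
      ring
    · intro Z _ _ h
      simp at h

/-- The discrete derivative `∑_Z (-1)^{|Z|} F(x · flip_{s(Z)})` of `F` at `x` in the coordinates of
the tuple `s`. -/
def cubeDeriv {ι : Type*} [DecidableEq ι] {ℓ : ℕ} (F : (ι → ℤˣ) → ℝ) (s : Fin ℓ → ι)
    (x : ι → ℤˣ) : ℝ :=
  ∑ Z : Finset (Fin ℓ), (-1) ^ Z.card * F (x * signFlip s Z)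

namespace QueryAlgorithm

variable {n r t w : ℕ}

theorem acceptProb_eq_inner (A : QueryAlgorithm n r t w) (x : Fin n → ℤˣ) :
    (A.acceptProb x : ℂ) = inner ℂ (A.finalState x) (A.M (A.finalState x)) := by
  have hsa : ContinuousLinearMap.adjoint (CFC.sqrt A.M) = CFC.sqrt A.M :=
    (CFC.sqrt_nonneg A.M).isSelfAdjoint
  have hsq : CFC.sqrt A.M * CFC.sqrt A.M = A.M := CFC.sqrt_mul_sqrt_self A.M A.M_nonneg
  rw [acceptProb, Complex.ofReal_pow, ← Complex.coe_algebraMap, ← inner_self_eq_norm_sq_to_K]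
  nth_rewrite 3 [← hsq]
  nth_rewrite 1 [← hsa]
  rw [ContinuousLinearMap.adjoint_inner_left]
  rfl

/-- Derivatives of the acceptance probability in `ℓ` coordinates, summed over the coordinates. Only
pairs of words covering all positions survive in the derivative. -/
theorem sum_abs_cubeDeriv_le (A : QueryAlgorithm n r t w) (hr : 1 ≤ r) (ht : 1 ≤ t) (htn : t ≤ n)
    {ℓ e : ℕ} (he : e ≤ ℓ) (hre : (2 * r - 1) * ℓ < 2 * r * (e + 1)) (x : Fin n → ℤˣ) :
    ∑ s : Fin ℓ → Fin n, |cubeDeriv A.acceptProb s x| ≤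
      ((3 ^ ℓ) ^ r) ^ 2 * √(((t : ℝ) / n) ^ (2 * ℓ - e) * ((n : ℝ) ^ ℓ) ^ 2) := by
  obtain ⟨ι, _, c, word, hc, hword, hexp⟩ := exists_word_expansion ℓ x A.ψ (r - 1)
    (fun i => (A.U i : StateSpace n t w →L[ℂ] StateSpace n t w)) fun i =>
      ContinuousLinearMap.opNorm_le_bound _ zero_le_one fun φ => by
        rw [Unitary.norm_map, one_mul]
  have hr1 : r - 1 + 1 = r := by omega
  rw [hr1] at hc
  set g : ι → (Fin ℓ → Fin n) → StateSpace n t w := fun i s => wordState oddQueries A.ψ s (word i)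
  set U : ι × ι → Finset (Fin ℓ) := fun p => wordSupport (word p.2) ∪ wordSupport (word p.1)
  set I : ι × ι → (Fin ℓ → Fin n) → ℂ := fun p s => inner ℂ (g p.1 s) (A.M (g p.2 s))
  have hprob : ∀ s Z, (A.acceptProb (x * signFlip s Z) : ℂ) =
      ∑ p : ι × ι, if U p ⊆ Z then star (c p.1) * c p.2 * I p s else 0 := by
    intro s Z
    rw [acceptProb_eq_inner, finalState, hexp s Z, map_sum, sum_inner, Fintype.sum_prod_type]
    refine Finset.sum_congr rfl fun i' _ => ?_
    rw [inner_sum]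
    refine Finset.sum_congr rfl fun i _ => ?_
    have hU : U (i', i) ⊆ Z ↔ wordSupport (word i) ⊆ Z ∧ wordSupport (word i') ⊆ Z :=
      Finset.union_subset_iff
    simp only [hU]
    by_cases h1 : wordSupport (word i) ⊆ Z <;> by_cases h2 : wordSupport (word i') ⊆ Z <;>
      simp [h1, h2, I, g, inner_smul_left, inner_smul_right, mul_assoc]
    ring
  have hderiv : ∀ s, |cubeDeriv A.acceptProb s x| ≤
      ∑ p : ι × ι, ‖c p.1‖ * ‖c p.2‖ * if U p = Finset.univ then ‖I p s‖ else 0 := by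
    intro s
    have hcast : ((cubeDeriv A.acceptProb s x : ℝ) : ℂ) = ∑ p : ι × ι, ∑ Z : Finset (Fin ℓ),
        (-1) ^ Z.card * if U p ⊆ Z then star (c p.1) * c p.2 * I p s else 0 := by
      rw [Finset.sum_comm, cubeDeriv]
      push_cast
      simp only [hprob, Finset.mul_sum]
    rw [← Real.norm_eq_abs, ← Complex.norm_real, hcast]
    refine (norm_sum_le _ _).trans (Finset.sum_le_sum fun p _ => ?_)
    rw [norm_sum_neg_one_pow_superset]
    simp only [norm_mul, norm_star, mul_ite, mul_zero, le_refl]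
  refine (Finset.sum_le_sum fun s _ => hderiv s).trans ?_
  rw [Finset.sum_comm, ← hc, sq, Finset.sum_mul_sum,
    ← Fintype.sum_prod_type' (f := fun i j => ‖c i‖ * ‖c j‖), Finset.sum_mul]
  refine Finset.sum_le_sum fun p _ => ?_
  rw [← Finset.mul_sum]
  refine mul_le_mul_of_nonneg_left ?_ (by positivity)
  by_cases hU : U p = Finset.univ
  · simp only [if_pos hU]
    have hmain := sum_norm_inner_wordState_le (ν := Fin n) oddQueries card_oddQueries_le
      (by simpa using htn) (by simp; omega) A.norm_ψ.le hr he hre (word p.2) (word p.1) A.M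
      A.norm_M_le (by rw [(hword p.2).1, hr1]) (by rw [(hword p.1).1, hr1]) (hword p.2).2
      (hword p.1).2 hU
    rwa [Fintype.card_fin] at hmain
  · simp only [if_neg hU, Finset.sum_const_zero]
    positivity

end QueryAlgorithm

/-! ### Fourier growth and discrete derivatives -/

section Fourier

variable {ι : Type*} [DecidableEq ι] {ℓ : ℕ}

theorem prod_signFlip_apply {s : Fin ℓ → ι} (hs : Function.Injective s) (Z : Finset (Fin ℓ)) :
    ∏ j, ((signFlip s Z (s j) : ℤ) : ℝ) = (-1) ^ Z.card := by
  have h : ∀ j, ((signFlip s Z (s j) : ℤ) : ℝ) = if j ∈ Z then -1 else 1 := by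
    intro j
    have hval : signFlip s Z (s j) = if j ∈ Z then -1 else 1 := by
      simp only [signFlip, Finset.prod_apply, Pi.mulSingle_apply, hs.eq_iff, Finset.prod_ite_eq]
    rw [hval]
    split_ifs <;> simp
  simp only [h]
  rw [← Finset.prod_filter]
  simp

/-- A Fourier coefficient of level `ℓ` is an average of `ℓ`-fold discrete derivatives, up to signs
and a factor `2 ^ ℓ`. -/
theorem two_pow_mul_abs_cubeFourierCoeff_le [Fintype ι] (F : (ι → ℤˣ) → ℝ) {s : Fin ℓ → ι}
    (hs : Function.Injective s) :
    2 ^ ℓ * |cubeFourierCoeff F (Finset.univ.image s)| ≤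
      (∑ x, |cubeDeriv F s x|) / 2 ^ Fintype.card ι := by
  set χ : (ι → ℤˣ) → ℝ := fun x => ∏ j, ((x (s j) : ℤ) : ℝ) with hχ
  have hχ1 : ∀ x, |χ x| = 1 := by
    intro x
    rw [hχ, Finset.abs_prod]
    refine Finset.prod_eq_one fun j _ => ?_
    rcases Int.units_eq_one_or (x (s j)) with h | h <;> simp [h]
  have hflip : ∀ Z, ∑ x, F x * χ x = ∑ x, χ x * ((-1) ^ Z.card * F (x * signFlip s Z)) := by
    intro Z
    rw [← Equiv.sum_comp (Equiv.mulRight (signFlip s Z)) fun x => F x * χ x]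
    refine Finset.sum_congr rfl fun x _ => ?_
    have hmul : χ (x * signFlip s Z) = χ x * (-1) ^ Z.card := by
      rw [← prod_signFlip_apply hs Z]
      simp only [hχ, Pi.mul_apply, Units.val_mul, Int.cast_mul, Finset.prod_mul_distrib]
    rw [Equiv.coe_mulRight, hmul]
    ring
  have hsum : 2 ^ ℓ * ∑ x, F x * χ x = ∑ x, χ x * cubeDeriv F s x := by
    have hcard : ∑ _Z : Finset (Fin ℓ), ∑ x, F x * χ x = 2 ^ ℓ * ∑ x, F x * χ x := by
      simp [Finset.card_univ]
    rw [← hcard, Finset.sum_congr rfl fun Z _ => hflip Z, Finset.sum_comm]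
    simp only [cubeDeriv, Finset.mul_sum]
  have hcoeff : cubeFourierCoeff F (Finset.univ.image s) =
      (∑ x, F x * χ x) / 2 ^ Fintype.card ι := by
    simp only [cubeFourierCoeff, Finset.prod_image fun i _ j _ h => hs h, hχ]
  rw [hcoeff, abs_div, abs_of_pos (by positivity : (0 : ℝ) < 2 ^ Fintype.card ι), ← mul_div_assoc]
  refine div_le_div_of_nonneg_right ?_ (by positivity)
  rw [← abs_of_pos (by positivity : (0 : ℝ) < 2 ^ ℓ), ← abs_mul, hsum]
  refine (Finset.abs_sum_le_sum_abs _ _).trans (Finset.sum_le_sum fun x _ => ?_)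
  rw [abs_mul, hχ1, one_mul]

theorem map_mul_signFlip {ν : Type*} [DecidableEq ν] {φ : (ι → ℤˣ) → ν → ℤˣ} {e : ι → ν}
    (hφ : ∀ x i, φ (x * Pi.mulSingle i (-1)) = φ x * Pi.mulSingle (e i) (-1))
    (s : Fin ℓ → ι) (Z : Finset (Fin ℓ)) (x : ι → ℤˣ) :
    φ (x * signFlip s Z) = φ x * signFlip (e ∘ s) Z := by
  induction Z using Finset.induction_on generalizing x with
  | empty => simp [signFlip]
  | insert j Z hj ih =>
    have h1 : signFlip s (insert j Z) = Pi.mulSingle (s j) (-1) * signFlip s Z :=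
      Finset.prod_insert hj
    have h2 : signFlip (e ∘ s) (insert j Z) =
        Pi.mulSingle (e (s j)) (-1) * signFlip (e ∘ s) Z := Finset.prod_insert hj
    rw [h1, h2, ← mul_assoc, ih, hφ, mul_assoc]

/-- A bound on the total `ℓ`-fold derivative of `f` at every point bounds the Fourier growth of
every function `f ∘ φ` obtained from `f` by an injective renaming and fixing of coordinates. -/
theorem two_pow_mul_fourierGrowth_comp_le [Fintype ι] {ν : Type*} [Fintype ν] [DecidableEq ν]
    {f : (ν → ℤˣ) → ℝ} {K : ℝ} (hf : ∀ x, ∑ s : Fin ℓ → ν, |cubeDeriv f s x| ≤ K)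
    {φ : (ι → ℤˣ) → ν → ℤˣ} {e : ι → ν} (he : Function.Injective e)
    (hφ : ∀ x i, φ (x * Pi.mulSingle i (-1)) = φ x * Pi.mulSingle (e i) (-1)) :
    2 ^ ℓ * fourierGrowth ℓ (fun x => f (φ x)) ≤ K := by
  have hex : ∀ S : Finset.powersetCard ℓ (Finset.univ : Finset ι), ∃ s : Fin ℓ → ι,
      Function.Injective s ∧ Finset.univ.image s = S := by
    rintro ⟨S, hS⟩
    have hcard := (Finset.mem_powersetCard.1 hS).2
    refine ⟨fun j => (S.equivFinOfCardEq hcard).symm j, ?_, ?_⟩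
    · exact Subtype.val_injective.comp (Equiv.injective _)
    · ext i
      simp only [Finset.mem_image, Finset.mem_univ, true_and]
      refine ⟨?_, fun hi => ⟨S.equivFinOfCardEq hcard ⟨i, hi⟩, by simp⟩⟩
      rintro ⟨j, rfl⟩
      exact Subtype.property _
  choose s hs hsS using hex
  have hinj : Function.Injective fun S => e ∘ s S := by
    intro S S' h
    have hS : s S = s S' := he.comp_left h
    exact Subtype.ext (by rw [← hsS S, ← hsS S', hS])
  have hpoint : ∀ x, ∑ S, |cubeDeriv (fun x => f (φ x)) (s S) x| ≤ K := by
    intro x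
    have hderiv : ∀ S, cubeDeriv (fun x => f (φ x)) (s S) x = cubeDeriv f (e ∘ s S) (φ x) :=
      fun S => by simp only [cubeDeriv, map_mul_signFlip hφ]
    simp only [hderiv]
    have hmap := Finset.sum_map Finset.univ ⟨fun S => e ∘ s S, hinj⟩
      fun s' => |cubeDeriv f s' (φ x)|
    refine hmap.ge.trans ?_
    exact (Finset.sum_le_univ_sum_of_nonneg fun _ => abs_nonneg _).trans (hf (φ x))
  rw [fourierGrowth, ← Finset.sum_coe_sort, Finset.mul_sum]
  calc ∑ S : Finset.powersetCard ℓ (Finset.univ : Finset ι),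
        2 ^ ℓ * |cubeFourierCoeff (fun x => f (φ x)) S|
      ≤ ∑ S, (∑ x, |cubeDeriv (fun x => f (φ x)) (s S) x|) / 2 ^ Fintype.card ι := by
        refine Finset.sum_le_sum fun S _ => ?_
        rw [← hsS S]
        exact two_pow_mul_abs_cubeFourierCoeff_le _ (hs S)
    _ = (∑ x, ∑ S, |cubeDeriv (fun x => f (φ x)) (s S) x|) / 2 ^ Fintype.card ι := by
        rw [← Finset.sum_div, Finset.sum_comm]
    _ ≤ (∑ _x : ι → ℤˣ, K) / 2 ^ Fintype.card ι := by
        gcongr with x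
        exact hpoint x
    _ = K := by
        simp

/-- Extending an assignment of the free coordinates by a restriction commutes with flipping a free
coordinate. -/
theorem mul_mulSingle_extend {n : ℕ} (ρ : Fin n → Option ℤˣ) (y : {i : Fin n // ρ i = none} → ℤˣ)
    (i : {i : Fin n // ρ i = none}) :
    (fun k => if h : ρ k = none then (y * Pi.mulSingle i (-1) : _ → ℤˣ) ⟨k, h⟩
        else (ρ k).getD 1) =
      (fun k => if h : ρ k = none then y ⟨k, h⟩ else (ρ k).getD 1) *
        Pi.mulSingle (i : Fin n) (-1) := by
  funext k
  by_cases h : ρ k = none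
  · by_cases hk : k = i
    · subst hk
      simp [h]
    · have hk' : (⟨k, h⟩ : {i : Fin n // ρ i = none}) ≠ i := fun h' => hk (congrArg Subtype.val h')
      simp [h, hk, hk']
  · have hk : k ≠ i := fun h' => h (h' ▸ i.2)
    simp [h, hk]

end Fourier

/-- The square root from Cauchy–Schwarz in the form `t ^ ℓ * (n / t) ^ (e / 2)`. -/
theorem sqrt_pow_mul_sq_eq {n t ℓ e : ℕ} (ht : 1 ≤ t) (hn : 1 ≤ n) (he : e ≤ ℓ) :
    √(((t : ℝ) / n) ^ (2 * ℓ - e) * ((n : ℝ) ^ ℓ) ^ 2) =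
      (t : ℝ) ^ ℓ * ((n : ℝ) / t) ^ ((1 / 2 : ℝ) * (e : ℝ)) := by
  have ht0 : (0 : ℝ) < t := by exact_mod_cast ht
  have hn0 : (0 : ℝ) < n := by exact_mod_cast hn
  have hsq : ((t : ℝ) / n) ^ (2 * ℓ - e) * ((n : ℝ) ^ ℓ) ^ 2 =
      ((t : ℝ) ^ ℓ) ^ 2 * ((n : ℝ) / t) ^ e := by
    obtain ⟨d, hd⟩ : ∃ d, 2 * ℓ = e + d := ⟨2 * ℓ - e, by omega⟩
    rw [← pow_mul, ← pow_mul, mul_comm ℓ 2, hd, Nat.add_sub_cancel_left, div_pow, div_pow]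
    field_simp
    ring
  rw [hsq, Real.sqrt_mul (by positivity), Real.sqrt_sq (by positivity), Real.sqrt_eq_rpow,
    ← Real.rpow_natCast _ e, ← Real.rpow_mul (by positivity), mul_comm (e : ℝ)]

end

theorem corollary4p2 :
    ∃ κ : ℕ → ℕ → ℝ,
      (∃ C : ℝ, ∀ r ℓ : ℕ, 1 ≤ r →
        0 ≤ κ r ℓ ∧
        κ r ℓ ≤ C * ((r : ℝ) * (ℓ : ℝ)) *
          min ((2 : ℝ) ^ (2 * r * ℓ)) ((ℓ : ℝ) ^ (4 ^ r))) ∧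
      ∀ (n t r w ℓ : ℕ), 1 ≤ r → 1 ≤ t → t ≤ n →
        ∀ A : QueryAlgorithm n r t w,
          fourierGrowth ℓ A.acceptProb ≤
            (2 : ℝ) ^ κ r ℓ * (t : ℝ) ^ ℓ *
              ((n : ℝ) / (t : ℝ)) ^
                ((1 / 2 : ℝ) * (⌊((2 * (r : ℝ) - 1) * (ℓ : ℝ)) / (2 * (r : ℝ))⌋₊ : ℝ)) ∧
          ∀ ρ : Fin n → Option ℤˣ,
            fourierGrowth ℓ (restrictFun A.acceptProb ρ) ≤
              (2 : ℝ) ^ κ r ℓ * (t : ℝ) ^ ℓ *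
                ((n : ℝ) / (t : ℝ)) ^
                  ((1 / 2 : ℝ) * (⌊((2 * (r : ℝ) - 1) * (ℓ : ℝ)) / (2 * (r : ℝ))⌋₊ : ℝ)) := by
  refine ⟨fun r ℓ => 4 * (r * ℓ), ⟨4, fun r ℓ hr => ⟨by positivity, ?_⟩⟩, ?_⟩
  · rcases Nat.eq_zero_or_pos ℓ with rfl | hℓ
    · simp
    · refine le_mul_of_one_le_right (by positivity) (le_min ?_ ?_)
      · exact one_le_pow₀ (by norm_num)
      · exact one_le_pow₀ (by exact_mod_cast hℓ)
  intro n t r w ℓ hr ht htn A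
  set e : ℕ := ⌊((2 * (r : ℝ) - 1) * (ℓ : ℝ)) / (2 * (r : ℝ))⌋₊ with he_def
  have hr0 : (0 : ℝ) < 2 * r := by positivity
  have hr1 : (1 : ℝ) ≤ r := by exact_mod_cast hr
  have he : e ≤ ℓ := by
    refine Nat.floor_le_of_le ?_
    rw [div_le_iff₀ hr0]
    nlinarith [(Nat.cast_nonneg ℓ : (0 : ℝ) ≤ ℓ)]
  have hre : (2 * r - 1) * ℓ < 2 * r * (e + 1) := by
    have h := Nat.lt_floor_add_one (((2 * (r : ℝ) - 1) * (ℓ : ℝ)) / (2 * (r : ℝ)))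
    rw [← he_def, div_lt_iff₀' hr0] at h
    have hsub : ((2 * r - 1 : ℕ) : ℝ) = 2 * (r : ℝ) - 1 := by
      rw [Nat.cast_sub (by omega)]
      push_cast
      ring
    rw [← hsub] at h
    exact_mod_cast h
  have hderiv := A.sum_abs_cubeDeriv_le hr ht htn he hre
  simp only [sqrt_pow_mul_sq_eq ht (ht.trans htn) he] at hderiv
  set B : ℝ := (t : ℝ) ^ ℓ * ((n : ℝ) / t) ^ ((1 / 2 : ℝ) * (e : ℝ)) with hB
  have hB0 : 0 ≤ B := by positivity
  -- `9 ^ (r * ℓ) ≤ 16 ^ (r * ℓ)`, and the factor `2 ^ ℓ` on the left is not needed.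
  have hconst : ∀ y : ℝ, 0 ≤ y → 2 ^ ℓ * y ≤ ((3 ^ ℓ) ^ r) ^ 2 * B →
      y ≤ (2 : ℝ) ^ (4 * ((r : ℝ) * ℓ)) * (t : ℝ) ^ ℓ *
        ((n : ℝ) / t) ^ ((1 / 2 : ℝ) * (e : ℝ)) := by
    intro y hy h
    have hpow : (2 : ℝ) ^ (4 * ((r : ℝ) * ℓ)) = 16 ^ (ℓ * r) := by
      rw [show 4 * ((r : ℝ) * ℓ) = ((4 * (ℓ * r) : ℕ) : ℝ) by push_cast; ring,
        Real.rpow_natCast, pow_mul]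
      norm_num
    have h3 : (((3 : ℝ) ^ ℓ) ^ r) ^ 2 = 9 ^ (ℓ * r) := by
      rw [← pow_mul 3 ℓ r, ← pow_mul, mul_comm (ℓ * r) 2, pow_mul]
      norm_num
    rw [mul_assoc, ← hB, hpow]
    calc y ≤ 2 ^ ℓ * y := le_mul_of_one_le_left hy (one_le_pow₀ (by norm_num))
      _ ≤ 9 ^ (ℓ * r) * B := h3 ▸ h
      _ ≤ 16 ^ (ℓ * r) * B := by gcongr; norm_num
  have hgrowth : ∀ {ι : Type} [Fintype ι] [DecidableEq ι] (F : (ι → ℤˣ) → ℝ),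
      0 ≤ fourierGrowth ℓ F := fun F => Finset.sum_nonneg fun _ _ => abs_nonneg _
  refine ⟨hconst _ (hgrowth _) ?_, fun ρ => hconst _ (hgrowth _) ?_⟩
  · exact two_pow_mul_fourierGrowth_comp_le hderiv (φ := id) Function.injective_id fun _ _ => rfl
  · exact two_pow_mul_fourierGrowth_comp_le hderiv Subtype.val_injective (mul_mulSingle_extend ρ)
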